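/- A (left) brace is a set $B$ with an abelian group structure $(B,+)$ and a group structure $(B,\cdot)$ such that $a\cdot(b+c)=a\cdot b-a+a\cdot c$ for all $a,b,c\in B$. Put $a\ast b=-a+a\cdot b-b$; let $B^1=B$ and let $B^{n+1}=B\ast B^n$ be the additive subgroup generated by all $a\ast b$ with $a\in B$, $b\in B^n$. Let $\langle S\rangle$ denote the smallest subbrace (subgroup for both operations) containing $S$. A brace homomorphism is a map that is a homomorphism for both operations. Theorem. Let $r\ge 0$ be an integer, let $X$ be the disjoint union of the alphabets \[X_1=\{\mathbf x_i\mid 1\le i\le r\},\quad X_2=\{\mathbf x_{ij}\mid 1\le i,j\le r\},\quad X_{3,1}=\{\mathbf x_{iij}\mid 1\le i,j\le r\},\quad X_{3,2}=\{\mathbf x_{ijk}\mid 1\le i<j\le r,\ 1\le k\le r\},\] and let $D$ be the free abelian group on $X$, whose elements are written $\mathbf d=\sum_\alpha d_\alpha\mathbf x_\alpha$ with $d_\alpha\in\mathbb Z$. Define a product on $D$ by $\mathbf d\cdot\mathbf e=\mathbf f$, where \[\begin{array}{ll} f_i=d_i+e_i & (1\le i\le r),\\ f_{ij}=d_{ij}+e_{ij}+d_ie_j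 & (1\le i,j\le r),\\ f_{iij}=d_{iij}+e_{iij}+\left(d_{ii}-\frac{d_i(d_i-1)}{2}\right)e_j & (1\le i,j\le r),\\ f_{ijk}=d_{ijk}+e_{ijk}+(d_{ij}-d_id_j+d_{ji})e_k & (1\le i<j\le r,\ 1\le k\le r). \end{array}\] Then $(D,+,\cdot)$ is a brace, $D^3=0$, and $D=\langle\mathbf x_1,\dots,\mathbf x_r\rangle$. Moreover, for every brace $C$ with $C^3=0$ and all $c_1,\dots,c_r\in C$ with $C=\langle c_1,\dots,c_r\rangle$, there is a unique brace homomorphism $\varphi\colon D\to C$ with $\varphi(\mathbf x_i)=c_i$ for every $1\le i\le r$, and $\varphi(D)=\langle c_1,\dots,c_r\rangle=C$. -/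

import Mathlib

/-- A (left) brace structure on the abelian group `(B, +)`: a second group structure `(B, *)` with
`a * (b + c) = a * b - a + a * c`. -/
class LeftBrace (B : Type*) [AddCommGroup B] extends Group B where
  /-- The left distributivity law of braces. -/
  brace_distrib : ∀ a b c : B, a * (b + c) = a * b - a + a * c

namespace LeftBrace

/-- The star operation of a brace, determined by `a * b = a + b + star a b`. -/
def star {B : Type*} [AddCommGroup B] [LeftBrace B] (a b : B) : B :=
  -a + a * b - b

/-- The product of two additive subgroups `S` and `T`: the additive subgroup generated by all
`star a b` with `a ∈ S` and `b ∈ T`. -/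
def starProd {B : Type*} [AddCommGroup B] [LeftBrace B] (S T : AddSubgroup B) : AddSubgroup B :=
  AddSubgroup.closure {x | ∃ a ∈ S, ∃ b ∈ T, x = star a b}

/-- The left series of a brace: the first term is the whole brace `B`, and term `n + 1` is the star
product of `B` with term `n`. (The index `0`, which is not used, is also given the value `B`.) -/
def leftPow (B : Type*) [AddCommGroup B] [LeftBrace B] : ℕ → AddSubgroup B
  | 0 => ⊤
  | 1 => ⊤
  | n + 2 => starProd ⊤ (leftPow B (n + 1))

end LeftBrace

/-- A subbrace: a subset that is a subgroup for both group structures. -/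
structure Subbrace (B : Type*) [AddCommGroup B] [LeftBrace B] extends AddSubgroup B, Subgroup B

/-- The smallest subbrace containing the set `S`: the intersection of all subbraces containing it. -/
def Subbrace.closure {B : Type*} [AddCommGroup B] [LeftBrace B] (S : Set B) : Subbrace B where
  carrier := {b | ∀ T : Subbrace B, S ⊆ T.carrier → b ∈ T.carrier}
  add_mem' ha hb T hT := T.add_mem' (ha T hT) (hb T hT)
  zero_mem' T _ := T.zero_mem'
  neg_mem' ha T hT := T.neg_mem' (ha T hT)
  mul_mem' ha hb T hT := T.mul_mem' (ha T hT) (hb T hT)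
  one_mem' T _ := T.one_mem'
  inv_mem' ha T hT := T.inv_mem' (ha T hT)

/-- A brace homomorphism: a map that is a homomorphism for both group structures. -/
structure BraceHom (A B : Type*) [AddCommGroup A] [LeftBrace A] [AddCommGroup B] [LeftBrace B]
    extends A →+ B, A →* B

instance BraceHom.instFunLike (A B : Type*) [AddCommGroup A] [LeftBrace A] [AddCommGroup B]
    [LeftBrace B] : FunLike (BraceHom A B) A B where
  coe f := f.toFun
  coe_injective f g h := by
    obtain ⟨⟨⟨f, _⟩, _⟩, _, _⟩ := f
    obtain ⟨⟨⟨g, _⟩, _⟩, _, _⟩ := g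
    congr

/-- The alphabet `X`, a disjoint union of four families of symbols. -/
inductive FreeBraceSymbol (r : ℕ) : Type
  /-- The symbols `x_i`. -/
  | x (i : Fin r)
  /-- The symbols `x_ij`. -/
  | xx (i j : Fin r)
  /-- The symbols `x_iij`. -/
  | xxSame (i j : Fin r)
  /-- The symbols `x_ijk` with `i < j` and `k` arbitrary. -/
  | xxx (i j : Fin r) (h : i < j) (k : Fin r)

/-- The free abelian group `D` on the alphabet `X`. -/
abbrev FreeBraceCarrier (r : ℕ) : Type :=
  FreeAbelianGroup (FreeBraceSymbol r)

/-- The coordinate `d_α` of an element `d` of `D` at the symbol `α`. -/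
noncomputable abbrev FreeBraceCarrier.coord {r : ℕ} (d : FreeBraceCarrier r) (α : FreeBraceSymbol r) : ℤ :=
  FreeAbelianGroup.coeff α d

/-! Write a∗b for `star a b`. It is always additive in b. If C^3 = 0, that is, a∗(b∗c) = 0, then
(a·b)∗c = a∗c + b∗c, and a·b = (a+b)·(a∗b) gives (a+b)∗c = a∗c + b∗c - (a∗b)∗c (`add_star`). Hence
(a∗b)∗c is symmetric and biadditive in (a, b), so everything is an additive combination of c_i,
c_i∗c_j and, for i ≤ j, (c_i∗c_j)∗c_k: the alphabet X. The term d_i(d_i-1)/2 records (nx)∗c = n(x∗c)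
- (n(n-1)/2)((x∗x)∗c). On D the product is a group law because the coefficients of the star are
additive under it (`starElt_mul_left`). For universality, the additive map sending each symbol to
its star monomial respects ∗ (`liftAdd_star`). -/

namespace LeftBrace

/-! ### Star calculus in an arbitrary brace. -/

section Basic

variable {B : Type*} [AddCommGroup B] [LeftBrace B]

theorem mul_zero_eq (a : B) : a * (0 : B) = a := by
  have h := brace_distrib a 0 0
  rw [add_zero] at h
  have h2 : a * (0 : B) - a = 0 := by
    have : a * (0 : B) + (a * (0 : B) - a) = a * (0 : B) + 0 := by
      rw [add_zero]; nth_rewrite 3 [h]; abel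
    exact add_left_cancel this
  exact sub_eq_zero.mp h2

theorem one_eq_zero : (1 : B) = 0 := by
  rw [← one_mul (0 : B), mul_zero_eq]

theorem mul_eq_add_star (a b : B) : a * b = a + b + star a b := by
  unfold star; abel

theorem star_add (a b c : B) : star a (b + c) = star a b + star a c := by
  unfold star; rw [brace_distrib]; abel

theorem star_zero (a : B) : star a 0 = 0 := by
  unfold star; rw [mul_zero_eq]; abel

theorem zero_star (a : B) : star 0 a = 0 := by
  unfold star; rw [← one_eq_zero, one_mul, one_eq_zero]; abel

/-- The map `star a` as an additive endomorphism. -/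
def starHom (a : B) : B →+ B where
  toFun := star a
  map_zero' := star_zero a
  map_add' := star_add a

/-- This is associativity of the multiplication, written through the star. -/
theorem mul_star (a b c : B) : star (a * b) c = star a (star b c) + star a c + star b c := by
  have h : a * b * c = a * (b * c) := mul_assoc a b c
  rw [mul_eq_add_star (a * b) c, mul_eq_add_star b c, mul_eq_add_star a (b + c + star b c),
    star_add, star_add, mul_eq_add_star a b] at h
  have h' : a + b + star a b + c + star (a + b + star a b) c =
      a + b + star a b + c + (star a (star b c) + star a c + star b c) := by
    rw [h]; abel
  rw [mul_eq_add_star a b]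
  exact add_left_cancel h'

theorem leftPow_three_eq_bot_iff :
    leftPow B 3 = ⊥ ↔ ∀ a b c : B, star a (star b c) = 0 := by
  constructor
  · intro h a b c
    have hmem : star a (star b c) ∈ leftPow B 3 :=
      AddSubgroup.subset_closure ⟨a, trivial, star b c,
        AddSubgroup.subset_closure ⟨b, trivial, c, trivial, rfl⟩, rfl⟩
    rwa [h, AddSubgroup.mem_bot] at hmem
  · intro h
    refine AddSubgroup.closure_eq_bot_iff.mpr ?_
    rintro _ ⟨a, -, b, hb, rfl⟩
    have hle : leftPow B 2 ≤ (starHom a).ker := by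
      refine (AddSubgroup.closure_le _).mpr ?_
      rintro _ ⟨b, -, c, -, rfl⟩
      exact h a b c
    exact hle hb

end Basic

/-! ### Identities in braces with vanishing third term. -/

section Nilpotent

variable {B : Type*} [AddCommGroup B] [LeftBrace B]

theorem add_star (h : ∀ a b c : B, star a (star b c) = 0) (a b c : B) :
    star (a + b) c = star a c + star b c - star (star a b) c := by
  have h1 : (a + b) * star a b = a * b := by
    rw [mul_eq_add_star, h, add_zero, mul_eq_add_star a b]
  have h2 := mul_star (a + b) (star a b) c
  rw [h1, mul_star, h, h] at h2
  rw [zero_add, zero_add] at h2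
  rw [h2]; abel

/-- The correction term in `add_star` inherits the symmetry of a + b. -/
theorem star_star_comm (h : ∀ a b c : B, star a (star b c) = 0) (a b c : B) :
    star (star a b) c = star (star b a) c := by
  have h1 := add_star h a b c
  have h2 := add_star h b a c
  rw [add_comm b a, h1, add_comm (star b c)] at h2
  exact sub_right_injective h2

theorem star_star_add_right (h : ∀ a b c : B, star a (star b c) = 0) (a b b' c : B) :
    star (star a (b + b')) c = star (star a b) c + star (star a b') c := by
  rw [star_add, add_star h, h, zero_star, sub_zero]

/-- The map `(a, b) ↦ star (star a b) c`, as a biadditive map. -/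
def starStarHom (h : ∀ a b c : B, star a (star b c) = 0) (c : B) : B →+ B →+ B :=
  AddMonoidHom.mk' (fun a => AddMonoidHom.mk' (fun b => star (star a b) c)
      fun b b' => star_star_add_right h a b b' c) fun a a' => by
    ext b
    change star (star (a + a') b) c = star (star a b) c + star (star a' b) c
    rw [star_star_comm h, star_star_add_right h, star_star_comm h b, star_star_comm h b]

end Nilpotent

end LeftBrace

/-! ### Subbraces and homomorphisms. -/

namespace Subbrace

variable {B : Type*} [AddCommGroup B] [LeftBrace B]

theorem star_mem (T : Subbrace B) {a b : B} (ha : a ∈ T.carrier) (hb : b ∈ T.carrier) :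
    LeftBrace.star a b ∈ T.carrier := by
  unfold LeftBrace.star
  rw [sub_eq_add_neg]
  exact T.add_mem' (T.add_mem' (T.neg_mem' ha) (T.mul_mem' ha hb)) (T.neg_mem' hb)

end Subbrace

namespace BraceHom

variable {A B : Type*} [AddCommGroup A] [LeftBrace A] [AddCommGroup B] [LeftBrace B]

theorem apply_add (φ : BraceHom A B) (a b : A) : φ (a + b) = φ a + φ b := φ.map_add' a b

theorem apply_mul (φ : BraceHom A B) (a b : A) : φ (a * b) = φ a * φ b := φ.map_mul' a b

theorem apply_zero (φ : BraceHom A B) : φ 0 = 0 := φ.map_zero'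

theorem apply_one (φ : BraceHom A B) : φ 1 = 1 := φ.map_one'

theorem apply_neg (φ : BraceHom A B) (a : A) : φ (-a) = -φ a := φ.toAddMonoidHom.map_neg a

theorem apply_inv (φ : BraceHom A B) (a : A) : φ a⁻¹ = (φ a)⁻¹ := φ.toMonoidHom.map_inv a

/-- The subbrace on which two brace homomorphisms agree. -/
def eqLocus (φ ψ : BraceHom A B) : Subbrace A where
  carrier := {a | φ a = ψ a}
  add_mem' {a b} ha hb := by
    simp only [Set.mem_ofPred_eq] at *
    rw [apply_add, apply_add, ha, hb]
  zero_mem' := by simp only [Set.mem_ofPred_eq, apply_zero]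
  neg_mem' {a} ha := by
    simp only [Set.mem_ofPred_eq] at *
    rw [apply_neg, apply_neg, ha]
  mul_mem' {a b} ha hb := by
    simp only [Set.mem_ofPred_eq] at *
    rw [apply_mul, apply_mul, ha, hb]
  one_mem' := by simp only [Set.mem_ofPred_eq, apply_one]
  inv_mem' {a} ha := by
    simp only [Set.mem_ofPred_eq] at *
    rw [apply_inv, apply_inv, ha]

/-- The image of a brace homomorphism, as a subbrace. -/
def range (φ : BraceHom A B) : Subbrace B where
  carrier := Set.range φ
  add_mem' := by
    rintro _ _ ⟨a, rfl⟩ ⟨b, rfl⟩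
    exact ⟨a + b, apply_add φ a b⟩
  zero_mem' := ⟨0, apply_zero φ⟩
  neg_mem' := by
    rintro _ ⟨a, rfl⟩
    exact ⟨-a, apply_neg φ a⟩
  mul_mem' := by
    rintro _ _ ⟨a, rfl⟩ ⟨b, rfl⟩
    exact ⟨a * b, apply_mul φ a b⟩
  one_mem' := ⟨1, apply_one φ⟩
  inv_mem' := by
    rintro _ ⟨a, rfl⟩
    exact ⟨a⁻¹, apply_inv φ a⟩

theorem ext_of_closure_eq_univ {S : Set A} (hS : (Subbrace.closure S).carrier = Set.univ)
    {φ ψ : BraceHom A B} (h : ∀ a ∈ S, φ a = ψ a) : φ = ψ := by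
  refine DFunLike.ext _ _ fun a => ?_
  have ha : a ∈ (Subbrace.closure S).carrier := hS ▸ Set.mem_univ a
  exact ha (eqLocus φ ψ) h

end BraceHom

instance FreeBraceSymbol.instFinite (r : ℕ) : Finite (FreeBraceSymbol r) := by
  let f : FreeBraceSymbol r → Fin 4 × Fin r × Fin r × Fin r
    | .x i => (0, i, i, i)
    | .xx i j => (1, i, j, j)
    | .xxSame i j => (2, i, j, j)
    | .xxx i j _ k => (3, i, j, k)
  refine Finite.of_injective f ?_
  intro a b hab
  cases a <;> cases b <;> simp_all [f]

/-! ### The polynomial brace structure on D. -/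

namespace FreeBraceCarrier

variable {r : ℕ}

open LeftBrace FreeAbelianGroup

/-- The element of the free abelian group with prescribed coordinates. -/
noncomputable def ofCoord (f : FreeBraceSymbol r → ℤ) : FreeBraceCarrier r :=
  Finsupp.toFreeAbelianGroup (Finsupp.equivFunOnFinite.symm f)

theorem coord_ofCoord (f : FreeBraceSymbol r → ℤ) (α : FreeBraceSymbol r) :
    (ofCoord f).coord α = f α := by
  change toFinsupp (Finsupp.toFreeAbelianGroup (Finsupp.equivFunOnFinite.symm f)) α = f α
  rw [toFinsupp_toFreeAbelianGroup]
  rfl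

theorem ext_coord {d e : FreeBraceCarrier r} (h : ∀ α, d.coord α = e.coord α) : d = e :=
  (equivFinsupp (FreeBraceSymbol r)).injective (Finsupp.ext h)

open Classical in
theorem coord_of (α β : FreeBraceSymbol r) :
    coord (FreeAbelianGroup.of α) β = if α = β then 1 else 0 := by
  change toFinsupp (FreeAbelianGroup.of α) β = _
  rw [toFinsupp_of, Finsupp.single_apply]

theorem triangle_add (a b : ℤ) :
    (a + b) * (a + b - 1) / 2 = a * (a - 1) / 2 + b * (b - 1) / 2 + a * b := by
  obtain ⟨k, hk⟩ := (Int.even_mul_pred_self a).two_dvd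
  obtain ⟨l, hl⟩ := (Int.even_mul_pred_self b).two_dvd
  have h : (a + b) * (a + b - 1) = 2 * (k + l + a * b) := by linear_combination hk + hl
  rw [h, hk, hl, Int.mul_ediv_cancel_left _ two_ne_zero, Int.mul_ediv_cancel_left _ two_ne_zero,
    Int.mul_ediv_cancel_left _ two_ne_zero]

/-- The coefficients at the symbols `x_iij` of the star product with an element. -/
noncomputable def diagCoeff (d : FreeBraceCarrier r) (i : Fin r) : ℤ :=
  d.coord (.xx i i) - d.coord (.x i) * (d.coord (.x i) - 1) / 2

/-- The coefficients at the symbols `x_ijk` of the star product with an element. -/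
noncomputable def offDiagCoeff (d : FreeBraceCarrier r) (i j : Fin r) : ℤ :=
  d.coord (.xx i j) - d.coord (.x i) * d.coord (.x j) + d.coord (.xx j i)

/-- The star product of the free brace, in coordinates. -/
noncomputable def starElt (d e : FreeBraceCarrier r) : FreeBraceCarrier r :=
  ofCoord fun
    | .x _ => 0
    | .xx i j => d.coord (.x i) * e.coord (.x j)
    | .xxSame i j => d.diagCoeff i * e.coord (.x j)
    | .xxx i j _ k => d.offDiagCoeff i j * e.coord (.x k)

theorem coord_starElt_x (d e : FreeBraceCarrier r) (i : Fin r) :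
    (starElt d e).coord (.x i) = 0 := coord_ofCoord _ _

theorem coord_starElt_xx (d e : FreeBraceCarrier r) (i j : Fin r) :
    (starElt d e).coord (.xx i j) = d.coord (.x i) * e.coord (.x j) := coord_ofCoord _ _

theorem coord_starElt_xxSame (d e : FreeBraceCarrier r) (i j : Fin r) :
    (starElt d e).coord (.xxSame i j) = d.diagCoeff i * e.coord (.x j) := coord_ofCoord _ _

theorem coord_starElt_xxx (d e : FreeBraceCarrier r) (i j : Fin r) (h : i < j) (k : Fin r) :
    (starElt d e).coord (.xxx i j h k) = d.offDiagCoeff i j * e.coord (.x k) := coord_ofCoord _ _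

/-- The product d_i e_i contributed at x_ii cancels the cross term of the triangular number, so this
coefficient is additive for the brace product. -/
theorem diagCoeff_add_starElt (d e : FreeBraceCarrier r) (i : Fin r) :
    (d + e + starElt d e).diagCoeff i = d.diagCoeff i + e.diagCoeff i := by
  simp only [diagCoeff, map_add, coord_starElt_x, coord_starElt_xx, add_zero, triangle_add]
  ring

theorem offDiagCoeff_add_starElt (d e : FreeBraceCarrier r) (i j : Fin r) :
    (d + e + starElt d e).offDiagCoeff i j = d.offDiagCoeff i j + e.offDiagCoeff i j := by
  simp only [offDiagCoeff, map_add, coord_starElt_x, coord_starElt_xx, add_zero]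
  ring

theorem starElt_add_right (d e f : FreeBraceCarrier r) :
    starElt d (e + f) = starElt d e + starElt d f := by
  refine ext_coord fun α => ?_
  cases α <;> simp only [map_add, coord_starElt_x, coord_starElt_xx, coord_starElt_xxSame,
    coord_starElt_xxx] <;> ring

theorem starElt_eq_zero (d e : FreeBraceCarrier r) (h : ∀ i, e.coord (.x i) = 0) :
    starElt d e = 0 := by
  refine ext_coord fun α => ?_
  cases α <;> simp only [map_zero, coord_starElt_x, coord_starElt_xx, coord_starElt_xxSame,
    coord_starElt_xxx, h, mul_zero]

theorem starElt_starElt (d e f : FreeBraceCarrier r) : starElt d (starElt e f) = 0 :=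
  starElt_eq_zero _ _ (coord_starElt_x e f)

theorem starElt_mul_left (d e f : FreeBraceCarrier r) :
    starElt (d + e + starElt d e) f = starElt d f + starElt e f := by
  refine ext_coord fun α => ?_
  cases α <;> simp only [map_add, coord_starElt_x, coord_starElt_xx, coord_starElt_xxSame,
    coord_starElt_xxx, diagCoeff_add_starElt, offDiagCoeff_add_starElt] <;> ring

theorem starElt_neg_right (d e : FreeBraceCarrier r) : starElt d (-e) = -starElt d e := by
  rw [eq_neg_iff_add_eq_zero, ← starElt_add_right, neg_add_cancel]
  exact starElt_eq_zero _ _ fun _ => map_zero _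

theorem mulElt_inv (d : FreeBraceCarrier r) :
    d + (-d + starElt d d) + starElt d (-d + starElt d d) = 0 := by
  rw [starElt_add_right, starElt_starElt, starElt_neg_right]
  abel

/-- The brace structure on the free abelian group given by the polynomial product. -/
noncomputable instance instLeftBrace (r : ℕ) : LeftBrace (FreeBraceCarrier r) :=
  letI : Mul (FreeBraceCarrier r) := ⟨fun d e => d + e + starElt d e⟩
  letI : One (FreeBraceCarrier r) := ⟨0⟩
  -- An inverse e solves e = -d - d∗e; as d∗ only sees the x_i coordinates, where e agrees with -d,
  -- this gives -d + d∗d.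
  letI : Inv (FreeBraceCarrier r) := ⟨fun d => -d + starElt d d⟩
  { Group.ofRightAxioms (G := FreeBraceCarrier r)
      (fun d e f => by
        change d + e + starElt d e + f + starElt (d + e + starElt d e) f =
          d + (e + f + starElt e f) + starElt d (e + f + starElt e f)
        rw [starElt_mul_left, starElt_add_right, starElt_add_right, starElt_starElt]
        abel)
      (fun d => by
        change d + 0 + starElt d 0 = d
        rw [starElt_eq_zero _ _ fun _ => map_zero _, add_zero, add_zero])
      mulElt_inv with
    brace_distrib := fun d e f => by
      change d + (e + f) + starElt d (e + f) = d + e + starElt d e - d + (d + f + starElt d f)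
      rw [starElt_add_right]
      abel }

theorem mul_def (d e : FreeBraceCarrier r) : d * e = d + e + starElt d e := rfl

theorem star_eq_starElt (d e : FreeBraceCarrier r) : star d e = starElt d e := by
  rw [LeftBrace.star, mul_def]; abel

theorem star_star_eq_zero (d e f : FreeBraceCarrier r) : star d (star e f) = 0 := by
  rw [star_eq_starElt, star_eq_starElt, starElt_starElt]

/-! ### Stars of symbols, and generation by the x_i. -/

theorem star_of_x_of_x (i j : Fin r) :
    star (FreeAbelianGroup.of (.x i) : FreeBraceCarrier r) (FreeAbelianGroup.of (.x j)) =
      FreeAbelianGroup.of (.xx i j) := by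
  rw [star_eq_starElt]
  refine ext_coord fun α => ?_
  cases α with
  | x => simp [coord_starElt_x, coord_of]
  | xx k l => simp [coord_starElt_xx, coord_of, ← ite_and, and_comm]
  | xxSame k l =>
    by_cases h : i = k <;> simp [coord_starElt_xxSame, coord_of, diagCoeff, h]
  | xxx k l h m =>
    have := h.ne
    by_cases h1 : i = k
    · subst h1; simp [coord_starElt_xxx, coord_of, offDiagCoeff, this]
    · simp [coord_starElt_xxx, coord_of, offDiagCoeff, h1]

theorem star_of_xx_same_of_x (i j : Fin r) :
    star (FreeAbelianGroup.of (.xx i i) : FreeBraceCarrier r) (FreeAbelianGroup.of (.x j)) =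
      FreeAbelianGroup.of (.xxSame i j) := by
  rw [star_eq_starElt]
  refine ext_coord fun α => ?_
  cases α with
  | x => simp [coord_starElt_x, coord_of]
  | xx k l => simp [coord_starElt_xx, coord_of]
  | xxSame k l => simp [coord_starElt_xxSame, coord_of, diagCoeff, ← ite_and, and_comm]
  | xxx k l h m =>
    have h2 : i = k → ¬ i = l := fun h1 h2 => h.ne (h1.symm.trans h2)
    have h3 : ¬ (i = l ∧ i = k) := fun ⟨h1, h3⟩ => h2 h3 h1
    simp only [coord_starElt_xxx, coord_of, offDiagCoeff, FreeBraceSymbol.xx.injEq,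
      not_and.mpr h2, h3, reduceCtorEq, if_false, mul_zero, sub_zero, add_zero, zero_mul]

theorem star_of_xx_of_x (i j : Fin r) (h : i < j) (k : Fin r) :
    star (FreeAbelianGroup.of (.xx i j) : FreeBraceCarrier r) (FreeAbelianGroup.of (.x k)) =
      FreeAbelianGroup.of (.xxx i j h k) := by
  rw [star_eq_starElt]
  refine ext_coord fun α => ?_
  cases α with
  | x => simp [coord_starElt_x, coord_of]
  | xx k l => simp [coord_starElt_xx, coord_of]
  | xxSame l m =>
    have h2 : ¬ (i = l ∧ j = l) := fun ⟨h1, h2⟩ => h.ne (h1.trans h2.symm)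
    simp [coord_starElt_xxSame, coord_of, diagCoeff, h2]
  | xxx l m h' n =>
    have h2 : ¬ (i = m ∧ j = l) := fun ⟨h1, h2⟩ => absurd (h1 ▸ h2 ▸ h) h'.asymm
    simp only [coord_starElt_xxx, coord_of, offDiagCoeff, FreeBraceSymbol.xx.injEq,
      FreeBraceSymbol.xxx.injEq, FreeBraceSymbol.x.injEq, reduceCtorEq, if_false, h2]
    by_cases h3 : i = l <;> by_cases h4 : j = m <;> simp [h3, h4]

theorem star_of_eq_zero (d : FreeBraceCarrier r) (α : FreeBraceSymbol r) (h : ∀ i, α ≠ .x i) :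
    star d (FreeAbelianGroup.of α) = 0 := by
  rw [star_eq_starElt]
  refine starElt_eq_zero _ _ fun i => ?_
  simp [coord_of, h]

theorem of_mem_of_x_mem (T : Subbrace (FreeBraceCarrier r))
    (hT : ∀ i, FreeAbelianGroup.of (.x i) ∈ T.carrier) (α : FreeBraceSymbol r) :
    FreeAbelianGroup.of α ∈ T.carrier := by
  have hxx : ∀ i j, FreeAbelianGroup.of (.xx i j) ∈ T.carrier := fun i j =>
    star_of_x_of_x i j ▸ T.star_mem (hT i) (hT j)
  cases α with
  | x i => exact hT i
  | xx i j => exact hxx i j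
  | xxSame i j => exact star_of_xx_same_of_x i j ▸ T.star_mem (hxx i i) (hT j)
  | xxx i j h k => exact star_of_xx_of_x i j h k ▸ T.star_mem (hxx i j) (hT k)

theorem closure_range_of_x : (Subbrace.closure (Set.range fun i : Fin r =>
    (FreeAbelianGroup.of (.x i) : FreeBraceCarrier r))).carrier = Set.univ := by
  refine Set.eq_univ_of_forall fun d T hT => ?_
  have hof := of_mem_of_x_mem T fun i => hT ⟨i, rfl⟩
  induction d using FreeAbelianGroup.induction_on with
  | zero => exact T.zero_mem'
  | of α => exact hof α
  | neg α ih => exact T.neg_mem' ih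
  | add d e hd he => exact T.add_mem' hd he

/-! ### The universal property. -/

section Lift

variable {C : Type*} [AddCommGroup C] [LeftBrace C] (c : Fin r → C)

/-- The additive map determined by the images of the generators `x_i`. -/
noncomputable def liftAdd : FreeBraceCarrier r →+ C :=
  FreeAbelianGroup.lift fun
    | .x i => c i
    | .xx i j => star (c i) (c j)
    | .xxSame i j => star (star (c i) (c i)) (c j)
    | .xxx i j _ k => star (star (c i) (c j)) (c k)

theorem liftAdd_x (i : Fin r) : liftAdd c (FreeAbelianGroup.of (.x i)) = c i :=
  FreeAbelianGroup.lift_apply_of _ _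

theorem liftAdd_xx (i j : Fin r) :
    liftAdd c (FreeAbelianGroup.of (.xx i j)) = star (c i) (c j) :=
  FreeAbelianGroup.lift_apply_of _ _

theorem liftAdd_xxSame (i j : Fin r) :
    liftAdd c (FreeAbelianGroup.of (.xxSame i j)) = star (star (c i) (c i)) (c j) :=
  FreeAbelianGroup.lift_apply_of _ _

theorem liftAdd_xxx (i j : Fin r) (h : i < j) (k : Fin r) :
    liftAdd c (FreeAbelianGroup.of (.xxx i j h k)) = star (star (c i) (c j)) (c k) :=
  FreeAbelianGroup.lift_apply_of _ _

variable {c}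

theorem star_liftAdd_of_eq_zero (h : ∀ a b c : C, star a (star b c) = 0) (a : C)
    (α : FreeBraceSymbol r) (hα : ∀ i, α ≠ .x i) :
    star a (liftAdd c (FreeAbelianGroup.of α)) = 0 := by
  cases α with
  | x i => exact absurd rfl (hα i)
  | xx i j => rw [liftAdd_xx, h]
  | xxSame i j => rw [liftAdd_xxSame, h]
  | xxx i j h' k => rw [liftAdd_xxx, h]

theorem liftAdd_star_xx_x (h : ∀ a b c : C, star a (star b c) = 0) (i j k : Fin r) :
    liftAdd c (star (FreeAbelianGroup.of (.xx i j)) (FreeAbelianGroup.of (.x k))) =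
      star (star (c i) (c j)) (c k) := by
  rcases lt_trichotomy i j with hij | rfl | hij
  · rw [star_of_xx_of_x i j hij, liftAdd_xxx]
  · rw [star_of_xx_same_of_x, liftAdd_xxSame]
  -- No symbol x_ijk exists for i > j; symmetry in both braces swaps the first two indices.
  · rw [← star_of_x_of_x, star_star_comm star_star_eq_zero, star_of_x_of_x,
      star_of_xx_of_x j i hij, liftAdd_xxx, star_star_comm h]

theorem liftAdd_star_star (h : ∀ a b c : C, star a (star b c) = 0) (d e : FreeBraceCarrier r)
    (k : Fin r) : liftAdd c (star (star d e) (FreeAbelianGroup.of (.x k))) =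
      star (star (liftAdd c d) (liftAdd c e)) (c k) := by
  -- Both sides are biadditive in (d, e), so symbols suffice; any symbol other than an x_i is killed
  -- in either slot.
  have key : (starStarHom star_star_eq_zero (FreeAbelianGroup.of (.x k))).compr₂ (liftAdd c) =
      ((starStarHom h (c k)).comp (liftAdd c)).compl₂ (liftAdd c) := by
    refine FreeAbelianGroup.lift_ext _ _ fun α => FreeAbelianGroup.lift_ext _ _ fun β => ?_
    change liftAdd c (star (star (FreeAbelianGroup.of α) (FreeAbelianGroup.of β)) _) =
      star (star (liftAdd c (FreeAbelianGroup.of α)) (liftAdd c (FreeAbelianGroup.of β))) (c k)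
    by_cases hβ : ∀ i, β ≠ .x i
    · rw [star_of_eq_zero _ β hβ, star_liftAdd_of_eq_zero h _ β hβ, zero_star, zero_star, map_zero]
    by_cases hα : ∀ i, α ≠ .x i
    · rw [star_star_comm star_star_eq_zero, star_star_comm h, star_of_eq_zero _ α hα,
        star_liftAdd_of_eq_zero h _ α hα, zero_star, zero_star, map_zero]
    push Not at hα hβ
    obtain ⟨i, rfl⟩ := hα
    obtain ⟨j, rfl⟩ := hβ
    rw [star_of_x_of_x, liftAdd_star_xx_x h, liftAdd_x, liftAdd_x]
  exact DFunLike.congr_fun (DFunLike.congr_fun key d) e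

theorem liftAdd_star_of_x (h : ∀ a b c : C, star a (star b c) = 0) (d : FreeBraceCarrier r)
    (k : Fin r) :
    liftAdd c (star d (FreeAbelianGroup.of (.x k))) = star (liftAdd c d) (c k) := by
  -- The star is not additive on the left, but `liftAdd_star_star` matches the defects. The
  -- equivalence serves sums and, with e = -d, negatives.
  have hadd : ∀ d e : FreeBraceCarrier r,
      liftAdd c (star d (FreeAbelianGroup.of (.x k))) = star (liftAdd c d) (c k) →
      (liftAdd c (star (d + e) (FreeAbelianGroup.of (.x k))) = star (liftAdd c (d + e)) (c k) ↔
      liftAdd c (star e (FreeAbelianGroup.of (.x k))) = star (liftAdd c e) (c k)) := by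
    intro d e hd
    rw [add_star star_star_eq_zero, map_add, add_star h, map_sub, map_add, liftAdd_star_star h, hd,
      sub_left_inj, add_right_inj]
  induction d using FreeAbelianGroup.induction_on with
  | zero => rw [zero_star, map_zero, zero_star]
  | of α =>
    cases α with
    | x i => rw [star_of_x_of_x, liftAdd_xx, liftAdd_x]
    | xx i j => rw [liftAdd_star_xx_x h, liftAdd_xx]
    | xxSame i j =>
      rw [← star_of_xx_same_of_x, liftAdd_star_star h, liftAdd_star_xx_x h, liftAdd_xx, liftAdd_x]
    | xxx i j hij l =>
      rw [← star_of_xx_of_x i j hij, liftAdd_star_star h, liftAdd_star_xx_x h, liftAdd_xx,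
        liftAdd_x]
  | neg α ih =>
    refine (hadd _ _ ih).mp ?_
    rw [add_neg_cancel, zero_star, map_zero, zero_star]
  | add d e hd he => exact (hadd d e hd).mpr he

theorem liftAdd_star (h : ∀ a b c : C, star a (star b c) = 0) (d e : FreeBraceCarrier r) :
    liftAdd c (star d e) = star (liftAdd c d) (liftAdd c e) := by
  have key : (liftAdd c).comp (starHom d) = (starHom (liftAdd c d)).comp (liftAdd c) := by
    refine FreeAbelianGroup.lift_ext _ _ fun α => ?_
    change liftAdd c (star d (FreeAbelianGroup.of α)) =
      star (liftAdd c d) (liftAdd c (FreeAbelianGroup.of α))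
    by_cases hα : ∀ i, α ≠ .x i
    · rw [star_of_eq_zero _ α hα, star_liftAdd_of_eq_zero h _ α hα, map_zero]
    · push Not at hα
      obtain ⟨i, rfl⟩ := hα
      rw [liftAdd_star_of_x h, liftAdd_x]
  exact DFunLike.congr_fun key e

/-- The brace homomorphism determined by the images of the generators `x_i`. -/
noncomputable def lift (h : ∀ a b c : C, star a (star b c) = 0) (c : Fin r → C) :
    BraceHom (FreeBraceCarrier r) C where
  toFun := liftAdd c
  map_zero' := map_zero _
  map_add' := map_add _
  map_one' := by
    rw [one_eq_zero, one_eq_zero]; exact map_zero _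
  map_mul' d e := by
    rw [mul_eq_add_star, map_add, map_add, liftAdd_star h, mul_eq_add_star]

theorem lift_of_x (h : ∀ a b c : C, star a (star b c) = 0) (c : Fin r → C) (i : Fin r) :
    lift h c (FreeAbelianGroup.of (.x i)) = c i := liftAdd_x c i

end Lift

end FreeBraceCarrier

theorem theoremC (r : ℕ) :
    ∃ _ : LeftBrace (FreeBraceCarrier r),
      -- the brace multiplication on the free abelian group `D` is the given polynomial product
      (∀ d e : FreeBraceCarrier r,
        (∀ i, (d * e).coord (.x i) = d.coord (.x i) + e.coord (.x i)) ∧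
        (∀ i j, (d * e).coord (.xx i j) =
          d.coord (.xx i j) + e.coord (.xx i j) + d.coord (.x i) * e.coord (.x j)) ∧
        (∀ i j, (d * e).coord (.xxSame i j) =
          d.coord (.xxSame i j) + e.coord (.xxSame i j) +
            (d.coord (.xx i i) - d.coord (.x i) * (d.coord (.x i) - 1) / 2) * e.coord (.x j)) ∧
        (∀ i j (h : i < j) k, (d * e).coord (.xxx i j h k) =
          d.coord (.xxx i j h k) + e.coord (.xxx i j h k) +
            (d.coord (.xx i j) - d.coord (.x i) * d.coord (.x j) + d.coord (.xx j i)) *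
              e.coord (.x k))) ∧
      -- the third term of the left series of `D` vanishes
      LeftBrace.leftPow (FreeBraceCarrier r) 3 = ⊥ ∧
      -- `D` is generated, as a brace, by the `x_i`
      (Subbrace.closure (Set.range fun i : Fin r =>
        (FreeAbelianGroup.of (.x i) : FreeBraceCarrier r))).carrier = Set.univ ∧
      -- `D` is free among the braces with these properties
      ∀ (C : Type*) [AddCommGroup C] [LeftBrace C] (c : Fin r → C),
        LeftBrace.leftPow C 3 = ⊥ →
        (Subbrace.closure (Set.range c)).carrier = Set.univ →
        (∃! φ : BraceHom (FreeBraceCarrier r) C, ∀ i, φ (FreeAbelianGroup.of (.x i)) = c i) ∧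
        ∀ φ : BraceHom (FreeBraceCarrier r) C, (∀ i, φ (FreeAbelianGroup.of (.x i)) = c i) →
          Set.range φ = (Subbrace.closure (Set.range c)).carrier := by
  refine ⟨FreeBraceCarrier.instLeftBrace r, fun d e => ⟨fun i => ?_, fun i j => ?_, fun i j => ?_,
    fun i j h k => ?_⟩, ?_, FreeBraceCarrier.closure_range_of_x, ?_⟩
  · simp only [FreeBraceCarrier.mul_def, map_add, FreeBraceCarrier.coord_starElt_x, add_zero]
  · simp only [FreeBraceCarrier.mul_def, map_add, FreeBraceCarrier.coord_starElt_xx]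
  · simp only [FreeBraceCarrier.mul_def, map_add, FreeBraceCarrier.coord_starElt_xxSame,
      FreeBraceCarrier.diagCoeff]
  · simp only [FreeBraceCarrier.mul_def, map_add, FreeBraceCarrier.coord_starElt_xxx,
      FreeBraceCarrier.offDiagCoeff]
  · exact LeftBrace.leftPow_three_eq_bot_iff.mpr FreeBraceCarrier.star_star_eq_zero
  · intro C _ _ c hC hc
    have h := LeftBrace.leftPow_three_eq_bot_iff.mp hC
    refine ⟨⟨FreeBraceCarrier.lift h c, FreeBraceCarrier.lift_of_x h c, fun ψ hψ => ?_⟩,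
      fun φ hφ => ?_⟩
    · refine BraceHom.ext_of_closure_eq_univ FreeBraceCarrier.closure_range_of_x ?_
      rintro _ ⟨i, rfl⟩
      exact (hψ i).trans (FreeBraceCarrier.lift_of_x h c i).symm
    · rw [hc]
      refine Set.eq_univ_of_forall fun y => ?_
      have hy : y ∈ (Subbrace.closure (Set.range c)).carrier := hc ▸ Set.mem_univ y
      -- The image is a subbrace containing the generators of C.
      refine hy φ.range ?_
      rintro _ ⟨i, rfl⟩
      exact ⟨_, hφ i⟩
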